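/- Let $\mathcal{E}\in(0,1)$, put $k=\sqrt{(1-\mathcal{E})/(1+\mathcal{E})}$, and let $$u_0(x)=\sqrt{1-\mathcal{E}}\;\mathrm{sn}\Bigl(x\sqrt{\tfrac{1+\mathcal{E}}{2}},\,k\Bigr),\qquad x\in\mathbb{R},$$ where $\mathrm{sn}(\cdot,k)$ is the Jacobi elliptic sine of modulus $k$; it is a real periodic solution of $u_0''+(1-u_0^2)u_0=0$. For $c\in\mathbb{R}$ let $\Lambda_c=S-cE$, where $S=R-\tfrac12(3-\mathcal{E}^2)Q$ and, for complex-valued $\psi$, $$E(\psi)=\int\Bigl[|\psi_x|^2+\tfrac12(1-|\psi|^2)^2\Bigr]dx,\qquad Q(\psi)=\int|\psi|^2\,dx,$$ $$R(\psi)=\int\Bigl[|\psi_{xx}|^2+3|\psi|^2|\psi_x|^2+\tfrac12(\bar\psi\psi_x+\psi\bar\psi_x)^2+\tfrac12|\psi|^6\Bigr]dx .$$ The second variation $\Lambda_c''(u_0)$ is the real quadratic form obtained by integrating over $\mathbb{R}$ the second derivative at $\epsilon=0$ of the density of $\Lambda_c$ at $u_0+\epsilon\varphi$, for perturbations $\varphi\in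 H^2(\mathbb{R};\mathbb{C})$. It is called positive except for two neutral directions due to symmetries if it is nonnegative on $H^2(\mathbb{R};\mathbb{C})$ and if every bounded function $\varphi:\mathbb{R}\to\mathbb{C}$ of class $C^4$ with $\Lambda_c''(u_0)\varphi=0$ (that is, the associated symmetric bilinear form of $\varphi$ with each smooth compactly supported complex-valued function vanishes) is a real linear combination of $u_0'$ (translations) and $i u_0$ (phase rotations). Then, for all $\mathcal{E}\in(0,1)$ and all $c\ge 1$, the second variation $\Lambda_c''(u_0)$ is positive except for two neutral directions due to symmetries only if $$c\in[c_-,c_+],\qquad c_\pm=2\pm\frac{2k}{1+k^2}.$$ -/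

import Mathlib

open MeasureTheory
open scoped ContDiff

noncomputable section

namespace NLSWave

/-! ### Jacobi's elliptic sine and the periodic wave profile -/

/-- The incomplete elliptic integral of the first kind
`F(φ, k) = ∫₀^φ dθ / √(1 - k² sin² θ)`; for `0 ≤ k < 1` it is an increasing bijection of `ℝ`
in the variable `φ`. -/
def ellipticF (k φ : ℝ) : ℝ :=
  ∫ θ in (0 : ℝ)..φ, 1 / √(1 - k ^ 2 * Real.sin θ ^ 2)

/-- The Jacobi amplitude `am(ξ, k)`, the inverse function of `φ ↦ F(φ, k)`. -/
def jacobiAm (ξ k : ℝ) : ℝ :=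
  Function.invFun (ellipticF k) ξ

/-- The Jacobi elliptic function `sn(ξ, k) = sin (am(ξ, k))`. -/
def jacobiSn (ξ k : ℝ) : ℝ :=
  Real.sin (jacobiAm ξ k)

/-- The elliptic modulus `k = √((1 - ℰ) / (1 + ℰ))`. -/
def modulus (ℰ : ℝ) : ℝ :=
  √((1 - ℰ) / (1 + ℰ))

/-- The profile `u₀(x) = √(1 - ℰ) sn(x √((1 + ℰ) / 2), k)`. -/
def profile (ℰ x : ℝ) : ℝ :=
  √(1 - ℰ) * jacobiSn (x * √((1 + ℰ) / 2)) (modulus ℰ)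

/-! ### The densities of the conserved quantities

The arguments `a, b, d` stand for the values `ψ(x), ψ'(x), ψ''(x)`. -/

/-- `|ψ_x|² + (1/2) (1 - |ψ|²)²`, the density of the energy `E`. -/
def energyDensity (a b : ℂ) : ℝ :=
  ‖b‖ ^ 2 + (1 / 2) * (1 - ‖a‖ ^ 2) ^ 2

/-- `|ψ|²`, the density of the charge `Q`. -/
def chargeDensity (a : ℂ) : ℝ :=
  ‖a‖ ^ 2

/-- `|ψ_xx|² + 3 |ψ|² |ψ_x|² + (1/2) (ψ̄ ψ_x + ψ ψ̄_x)² + (1/2) |ψ|⁶`, the density of the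
higher-order functional `R`. The quantity `ψ̄ ψ_x + ψ ψ̄_x` is real, and the real part only
turns it into a real number. -/
def higherDensity (a b d : ℂ) : ℝ :=
  ‖d‖ ^ 2 + 3 * ‖a‖ ^ 2 * ‖b‖ ^ 2
    + (1 / 2) * ((starRingEnd ℂ a * b + a * starRingEnd ℂ b).re) ^ 2
    + (1 / 2) * ‖a‖ ^ 6

/-- The density of `Λ_c = S - c E`, where `S = R - (1/2) (3 - ℰ²) Q`. -/
def lambdaDensity (ℰ c : ℝ) (a b d : ℂ) : ℝ :=
  higherDensity a b d - (1 / 2) * (3 - ℰ ^ 2) * chargeDensity a - c * energyDensity a b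

/-! ### The second variation at the profile -/

/-- The integrand at `x` of the second variation of `Λ_c` at `u₀`, as a symmetric bilinear
form: the mixed derivative at `s = t = 0` of the density of `Λ_c` at `u₀ + s φ + t η`, where
`(a, b, d)` and `(a', b', d')` are the values at `x` of `φ, φ', φ''` and `η, η', η''`. -/
def secondVariationDensity (ℰ c x : ℝ) (a b d a' b' d' : ℂ) : ℝ :=
  deriv (fun s : ℝ => deriv (fun t : ℝ =>
    lambdaDensity ℰ c
      ((profile ℰ x : ℂ) + s * a + t * a')
      (((deriv (profile ℰ) x : ℝ) : ℂ) + s * b + t * b')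
      (((deriv (deriv (profile ℰ)) x : ℝ) : ℂ) + s * d + t * d')) 0) 0

/-- `⟨Λ_c''(u₀) φ, η⟩` on the whole line, for perturbations `φ, η` whose first and second
derivatives are `φ₁, φ₂` and `η₁, η₂`. -/
def secondVariation (ℰ c : ℝ) (φ φ₁ φ₂ η η₁ η₂ : ℝ → ℂ) : ℝ :=
  ∫ x, secondVariationDensity ℰ c x (φ x) (φ₁ x) (φ₂ x) (η x) (η₁ x) (η₂ x)

/-- `g` is a weak derivative of `f` on `ℝ`. -/
def HasWeakDeriv (f g : ℝ → ℂ) : Prop :=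
  ∀ η : ℝ → ℝ, ContDiff ℝ ∞ η → HasCompactSupport η →
    ∫ x, deriv η x • f x = - ∫ x, η x • g x

/-- `φ` belongs to the Sobolev space `H²(ℝ)` of complex-valued functions, with weak
derivatives `φ₁` and `φ₂` of order one and two. -/
structure MemH2 (φ φ₁ φ₂ : ℝ → ℂ) : Prop where
  memLp : MemLp φ 2 volume
  memLp₁ : MemLp φ₁ 2 volume
  memLp₂ : MemLp φ₂ 2 volume
  weakDeriv₁ : HasWeakDeriv φ φ₁
  weakDeriv₂ : HasWeakDeriv φ₁ φ₂

/-- `φ` is a neutral direction of `Λ_c''(u₀)`: a bounded solution of `Λ_c''(u₀) φ = 0`, the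
equation being understood by pairing with test functions. (Bounded solutions in a larger local
Sobolev class satisfy a fourth-order equation with smooth coefficients and are therefore smooth.) -/
structure IsNeutral (ℰ c : ℝ) (φ : ℝ → ℂ) : Prop where
  contDiff : ContDiff ℝ 4 φ
  bounded : ∃ C : ℝ, ∀ x, ‖φ x‖ ≤ C
  eq_zero : ∀ η : ℝ → ℂ, ContDiff ℝ ∞ η → HasCompactSupport η →
    secondVariation ℰ c φ (deriv φ) (deriv (deriv φ)) η (deriv η) (deriv (deriv η)) = 0

/-- The second variation `Λ_c''(u₀)` is positive except for the two neutral directions due to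
symmetries: it is nonnegative on `H²(ℝ)`, and its only neutral directions are the real linear
combinations of `u₀'` (translations) and `i u₀` (phase rotations). -/
structure IsPositiveExceptSymmetries (ℰ c : ℝ) : Prop where
  nonneg : ∀ φ φ₁ φ₂ : ℝ → ℂ, MemH2 φ φ₁ φ₂ →
    0 ≤ secondVariation ℰ c φ φ₁ φ₂ φ φ₁ φ₂
  neutral : ∀ φ : ℝ → ℂ, IsNeutral ℰ c φ →
    ∃ α β : ℝ, ∀ x,
      φ x = α * ((deriv (profile ℰ) x : ℝ) : ℂ) + β * (Complex.I * (profile ℰ x : ℂ))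

/-- `c₋ = 2 - 2k / (1 + k²)`. -/
def cMinus (ℰ : ℝ) : ℝ :=
  2 - 2 * modulus ℰ / (1 + modulus ℰ ^ 2)

/-- `c₊ = 2 + 2k / (1 + k²)`. -/
def cPlus (ℰ : ℝ) : ℝ :=
  2 + 2 * modulus ℰ / (1 + modulus ℰ ^ 2)

end NLSWave

end

/-!
In a purely imaginary direction `iv`, with `p = u₀`, `h = v'' + (1 - p²) v` and the Wronskian
`w = p v' - p' v`, the second variation is twice `∫ h² + w² + (c - 2) v h`. For either root `a` of
`a² = 1 - ℰ²` the Euler-Lagrange equation of this form at `c = 2 + a` has, besides `p`, the linearly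
growing solution `θ p - 2 a p'` with `θ' = a (p² + a)`. Cutting it off slowly, that is, testing with
`v = F(εθ) p - 2 ε a F'(εθ) p'`, makes `h` and `w` free of `F(εθ)` itself, and the form becomes
`ε² a (2 + a - c) ∫ F'(εθ)² (θ'² + 4 a² p'²)` up to terms of order `ε³` on an interval of length
`O(1 / ε)`. Hence nonnegativity forces `0 ≤ a (2 + a - c)`; the two roots `a = ± √(1 - ℰ²)` give
the two bounds on `c`.
-/

namespace NLSWave

section JacobiElliptic

variable {k : ℝ}

theorem one_sub_sq_mul_sin_sq_pos (hk : k ^ 2 < 1) (θ : ℝ) :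
    0 < 1 - k ^ 2 * Real.sin θ ^ 2 := by
  nlinarith [Real.sin_sq_le_one θ, sq_nonneg (Real.sin θ)]

theorem hasDerivAt_ellipticF (hk : k ^ 2 < 1) (φ : ℝ) :
    HasDerivAt (ellipticF k) (1 / √(1 - k ^ 2 * Real.sin φ ^ 2)) φ := by
  have hcont : Continuous fun θ : ℝ => 1 / √(1 - k ^ 2 * Real.sin θ ^ 2) :=
    continuous_const.div (by fun_prop) fun θ =>
      (Real.sqrt_pos.2 (one_sub_sq_mul_sin_sq_pos hk θ)).ne'
  exact (hcont.integral_hasStrictDerivAt 0 φ).hasDerivAt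

theorem one_le_deriv_ellipticF (hk : k ^ 2 < 1) (φ : ℝ) : 1 ≤ deriv (ellipticF k) φ := by
  rw [(hasDerivAt_ellipticF hk φ).deriv,
    one_le_div (Real.sqrt_pos.2 (one_sub_sq_mul_sin_sq_pos hk φ)), Real.sqrt_le_one]
  exact sub_le_self _ (by positivity)

theorem strictMono_ellipticF (hk : k ^ 2 < 1) : StrictMono (ellipticF k) :=
  strictMono_of_deriv_pos fun φ => one_pos.trans_le (one_le_deriv_ellipticF hk φ)

theorem surjective_ellipticF (hk : k ^ 2 < 1) : Function.Surjective (ellipticF k) := by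
  have hdiff : Differentiable ℝ (ellipticF k) := fun φ =>
    (hasDerivAt_ellipticF hk φ).differentiableAt
  have hgrowth := mul_sub_le_image_sub_of_le_deriv hdiff (one_le_deriv_ellipticF hk)
  have hzero : ellipticF k 0 = 0 := intervalIntegral.integral_same
  refine hdiff.continuous.surjective
    (Filter.tendsto_atTop_mono' _ ?_ Filter.tendsto_id)
    (Filter.tendsto_atBot_mono' _ ?_ Filter.tendsto_id)
  · filter_upwards [Filter.eventually_ge_atTop 0] with φ hφ
    simpa [hzero] using hgrowth hφ
  · filter_upwards [Filter.eventually_le_atBot 0] with φ hφ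
    simpa [hzero] using hgrowth hφ

theorem ellipticF_jacobiAm (hk : k ^ 2 < 1) (ξ : ℝ) : ellipticF k (jacobiAm ξ k) = ξ :=
  Function.invFun_eq (surjective_ellipticF hk ξ)

theorem continuous_jacobiAm (hk : k ^ 2 < 1) : Continuous fun ξ => jacobiAm ξ k := by
  have hF := strictMono_ellipticF hk
  refine Monotone.continuous_of_surjective (fun ξ ξ' h => ?_) fun φ =>
    ⟨ellipticF k φ, Function.leftInverse_invFun hF.injective φ⟩
  rwa [← hF.le_iff_le, ellipticF_jacobiAm hk, ellipticF_jacobiAm hk]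

/-- The Jacobi elliptic cosine `cn(ξ, k) = cos (am(ξ, k))`, a factor of the derivative of `sn`. -/
noncomputable def jacobiCn (ξ k : ℝ) : ℝ :=
  Real.cos (jacobiAm ξ k)

/-- The Jacobi delta amplitude `dn(ξ, k) = √(1 - k² sn²(ξ, k))`, the derivative of `am`. The
positive root is the standard function only for `k² ≤ 1`. -/
noncomputable def jacobiDn (ξ k : ℝ) : ℝ :=
  √(1 - k ^ 2 * jacobiSn ξ k ^ 2)

theorem jacobiCn_sq (ξ k : ℝ) : jacobiCn ξ k ^ 2 = 1 - jacobiSn ξ k ^ 2 :=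
  Real.cos_sq' _

theorem jacobiDn_pos (hk : k ^ 2 < 1) (ξ : ℝ) : 0 < jacobiDn ξ k :=
  Real.sqrt_pos.2 (one_sub_sq_mul_sin_sq_pos hk _)

theorem jacobiDn_sq (hk : k ^ 2 < 1) (ξ : ℝ) : jacobiDn ξ k ^ 2 = 1 - k ^ 2 * jacobiSn ξ k ^ 2 :=
  Real.sq_sqrt (one_sub_sq_mul_sin_sq_pos hk _).le

theorem hasDerivAt_jacobiAm (hk : k ^ 2 < 1) (ξ : ℝ) :
    HasDerivAt (fun ξ => jacobiAm ξ k) (jacobiDn ξ k) ξ := by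
  have h := HasDerivAt.of_local_left_inverse (continuous_jacobiAm hk).continuousAt
    (hasDerivAt_ellipticF hk (jacobiAm ξ k)) (one_div_pos.2 (jacobiDn_pos hk ξ)).ne'
    (Filter.Eventually.of_forall fun ξ => ellipticF_jacobiAm hk ξ)
  rwa [one_div, inv_inv] at h

theorem hasDerivAt_jacobiSn (hk : k ^ 2 < 1) (ξ : ℝ) :
    HasDerivAt (fun ξ => jacobiSn ξ k) (jacobiCn ξ k * jacobiDn ξ k) ξ :=
  (hasDerivAt_jacobiAm hk ξ).sin

theorem hasDerivAt_jacobiCn (hk : k ^ 2 < 1) (ξ : ℝ) :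
    HasDerivAt (fun ξ => jacobiCn ξ k) (-jacobiSn ξ k * jacobiDn ξ k) ξ :=
  (hasDerivAt_jacobiAm hk ξ).cos

theorem hasDerivAt_jacobiDn (hk : k ^ 2 < 1) (ξ : ℝ) :
    HasDerivAt (fun ξ => jacobiDn ξ k) (-k ^ 2 * jacobiSn ξ k * jacobiCn ξ k) ξ := by
  have hdn := jacobiDn_pos hk ξ
  refine ((((hasDerivAt_jacobiSn hk ξ).pow 2).const_mul (k ^ 2)).const_sub 1 |>.sqrt
    (one_sub_sq_mul_sin_sq_pos hk _).ne').congr_deriv ?_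
  change _ / (2 * jacobiDn ξ k) = _
  field_simp
  push_cast
  ring

theorem hasDerivAt_jacobiCn_mul_jacobiDn (hk : k ^ 2 < 1) (ξ : ℝ) :
    HasDerivAt (fun ξ => jacobiCn ξ k * jacobiDn ξ k)
      (2 * k ^ 2 * jacobiSn ξ k ^ 3 - (1 + k ^ 2) * jacobiSn ξ k) ξ := by
  refine ((hasDerivAt_jacobiCn hk ξ).mul (hasDerivAt_jacobiDn hk ξ)).congr_deriv ?_
  linear_combination (-jacobiSn ξ k) * jacobiDn_sq hk ξ - k ^ 2 * jacobiSn ξ k * jacobiCn_sq ξ k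

end JacobiElliptic

theorem continuous_of_hasDerivAt {E : Type*} [NormedAddCommGroup E] [NormedSpace ℝ E]
    {f f' : ℝ → E} (h : ∀ x, HasDerivAt f (f' x) x) : Continuous f :=
  continuous_iff_continuousAt.2 fun x => (h x).continuousAt

/-- A real solution `p`, with derivative `q`, of the profile equation `p'' + (1 - p²) p = 0` at the
level `ℰ²` of its first integral `(1 - p²)² - 2 p'²`. -/
structure IsWave (ℰ : ℝ) (p q : ℝ → ℝ) : Prop where
  hasDerivAt : ∀ x, HasDerivAt p (q x) x
  hasDerivAt_deriv : ∀ x, HasDerivAt q (p x ^ 3 - p x) x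
  sq_deriv : ∀ x, q x ^ 2 = ((1 - p x ^ 2) ^ 2 - ℰ ^ 2) / 2

section Profile

variable {ℰ : ℝ} {p q : ℝ → ℝ}

theorem IsWave.continuous (hp : IsWave ℰ p q) : Continuous p :=
  continuous_of_hasDerivAt hp.hasDerivAt

theorem IsWave.continuous_deriv (hp : IsWave ℰ p q) : Continuous q :=
  continuous_of_hasDerivAt hp.hasDerivAt_deriv

theorem IsWave.sq_deriv_le_one (hp : IsWave ℰ p q) {x : ℝ} (hpx : p x ^ 2 ≤ 1) : q x ^ 2 ≤ 1 := by
  nlinarith [hp.sq_deriv x, sq_nonneg (p x), sq_nonneg ℰ]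

theorem modulus_sq (hℰ : ℰ ∈ Set.Ioo (0 : ℝ) 1) : modulus ℰ ^ 2 = (1 - ℰ) / (1 + ℰ) :=
  Real.sq_sqrt (div_nonneg (by linarith [hℰ.2]) (by linarith [hℰ.1]))

theorem modulus_sq_lt_one (hℰ : ℰ ∈ Set.Ioo (0 : ℝ) 1) : modulus ℰ ^ 2 < 1 := by
  rw [modulus_sq hℰ, div_lt_one (by linarith [hℰ.1])]
  linarith [hℰ.1]

theorem two_mul_modulus_div (hℰ : ℰ ∈ Set.Ioo (0 : ℝ) 1) :
    2 * modulus ℰ / (1 + modulus ℰ ^ 2) = √(1 - ℰ ^ 2) := by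
  have hpos : 0 < 1 + ℰ := by linarith [hℰ.1]
  have hmul : √(1 - ℰ ^ 2) = modulus ℰ * (1 + ℰ) := by
    rw [modulus, ← Real.sqrt_sq hpos.le, ← Real.sqrt_mul' _ (sq_nonneg _), Real.sqrt_sq hpos.le]
    congr 1
    field_simp
    ring
  rw [modulus_sq hℰ, hmul]
  field_simp
  ring

theorem hasDerivAt_profile (hℰ : ℰ ∈ Set.Ioo (0 : ℝ) 1) (x : ℝ) :
    HasDerivAt (profile ℰ)
      (√(1 - ℰ) * √((1 + ℰ) / 2) * (jacobiCn (x * √((1 + ℰ) / 2)) (modulus ℰ) *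
        jacobiDn (x * √((1 + ℰ) / 2)) (modulus ℰ))) x := by
  refine (((hasDerivAt_jacobiSn (modulus_sq_lt_one hℰ) (x * √((1 + ℰ) / 2))).comp x
    (hasDerivAt_mul_const _)).const_mul (√(1 - ℰ))).congr_deriv ?_
  ring

theorem isWave_profile (hℰ : ℰ ∈ Set.Ioo (0 : ℝ) 1) :
    IsWave ℰ (profile ℰ) (deriv (profile ℰ)) := by
  have hk := modulus_sq_lt_one hℰ
  have hden : 0 < 1 + ℰ := by linarith [hℰ.1]
  have hA : √(1 - ℰ) ^ 2 = 1 - ℰ := Real.sq_sqrt (by linarith [hℰ.2])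
  have hb : √((1 + ℰ) / 2) ^ 2 = (1 + ℰ) / 2 := Real.sq_sqrt (by linarith)
  have hkb : modulus ℰ ^ 2 * √((1 + ℰ) / 2) ^ 2 = (1 - ℰ) / 2 := by
    rw [modulus_sq hℰ, hb]
    field_simp
  have hderiv := funext fun x => (hasDerivAt_profile hℰ x).deriv
  refine ⟨fun x => (hasDerivAt_profile hℰ x).differentiableAt.hasDerivAt, fun x => ?_, fun x => ?_⟩
  · rw [hderiv]
    refine (((hasDerivAt_jacobiCn_mul_jacobiDn hk (x * √((1 + ℰ) / 2))).comp x
      (hasDerivAt_mul_const _)).const_mul (√(1 - ℰ) * √((1 + ℰ) / 2))).congr_deriv ?_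
    rw [profile]
    generalize jacobiSn (x * √((1 + ℰ) / 2)) (modulus ℰ) = s
    generalize √(1 - ℰ) = A at *
    linear_combination -A * s ^ 3 * hA + (2 * A * s ^ 3 - A * s) * hkb - A * s * hb
  · rw [hderiv, profile]
    simp only [mul_pow, jacobiCn_sq, jacobiDn_sq hk]
    generalize jacobiSn (x * √((1 + ℰ) / 2)) (modulus ℰ) = s
    rw [hA]
    linear_combination (1 - ℰ) * (1 - s ^ 2) * (hb - s ^ 2 * hkb)

theorem profile_sq_le (hℰ : ℰ ≤ 1) (x : ℝ) : profile ℰ x ^ 2 ≤ 1 - ℰ := by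
  rw [profile, mul_pow, Real.sq_sqrt (sub_nonneg.2 hℰ)]
  exact mul_le_of_le_one_right (sub_nonneg.2 hℰ) (Real.sin_sq_le_one _)

end Profile

section ImaginaryDirection

theorem secondVariationDensity_self (ℰ c x : ℝ) (a b d : ℂ) :
    secondVariationDensity ℰ c x a b d a b d =
      deriv (deriv fun s : ℝ => lambdaDensity ℰ c ((profile ℰ x : ℂ) + s * a)
        (((deriv (profile ℰ) x : ℝ) : ℂ) + s * b)
        (((deriv (deriv (profile ℰ)) x : ℝ) : ℂ) + s * d)) 0 := by
  set Φ : ℝ → ℝ := fun s => lambdaDensity ℰ c ((profile ℰ x : ℂ) + s * a)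
    (((deriv (profile ℰ) x : ℝ) : ℂ) + s * b)
    (((deriv (deriv (profile ℰ)) x : ℝ) : ℂ) + s * d) with hΦ
  have hshift : ∀ s, deriv (fun t => Φ (s + t)) 0 = deriv Φ s := fun s => by
    rw [deriv_comp_const_add, add_zero]
  rw [← funext hshift, secondVariationDensity]
  simp only [hΦ, Complex.ofReal_add, add_mul, add_assoc]

theorem lambdaDensity_mk (ℰ c p q r y y₁ y₂ : ℝ) :
    lambdaDensity ℰ c ⟨p, y⟩ ⟨q, y₁⟩ ⟨r, y₂⟩ =
      r ^ 2 + y₂ ^ 2 + 3 * (p ^ 2 + y ^ 2) * (q ^ 2 + y₁ ^ 2) + 2 * (p * q + y * y₁) ^ 2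
        + 1 / 2 * (p ^ 2 + y ^ 2) ^ 3 - 1 / 2 * (3 - ℰ ^ 2) * (p ^ 2 + y ^ 2)
        - c * (q ^ 2 + y₁ ^ 2 + 1 / 2 * (1 - (p ^ 2 + y ^ 2)) ^ 2) := by
  have hnorm : ∀ a b : ℝ, ‖(⟨a, b⟩ : ℂ)‖ ^ 2 = a ^ 2 + b ^ 2 := fun a b => by
    rw [Complex.sq_norm, Complex.normSq_mk]
    ring
  have hnorm₆ : ‖(⟨p, y⟩ : ℂ)‖ ^ 6 = (p ^ 2 + y ^ 2) ^ 3 := by rw [← hnorm, ← pow_mul]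
  simp only [lambdaDensity, higherDensity, chargeDensity, energyDensity, hnorm, hnorm₆,
    Complex.add_re, Complex.mul_re, Complex.conj_re, Complex.conj_im]
  ring

theorem deriv_deriv_even_sextic (a₀ a₂ a₄ a₆ : ℝ) :
    deriv (deriv fun s : ℝ => a₀ + a₂ * s ^ 2 + a₄ * s ^ 4 + a₆ * s ^ 6) 0 = 2 * a₂ := by
  have hfirst : (deriv fun s : ℝ => a₀ + a₂ * s ^ 2 + a₄ * s ^ 4 + a₆ * s ^ 6) =
      fun s => a₂ * (2 * s) + a₄ * (4 * s ^ 3) + a₆ * (6 * s ^ 5) := by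
    funext s
    exact (((((hasDerivAt_pow 2 s).const_mul a₂).const_add a₀).add
      ((hasDerivAt_pow 4 s).const_mul a₄)).add ((hasDerivAt_pow 6 s).const_mul a₆)).deriv.trans
      (by norm_num)
  rw [hfirst]
  exact (((((hasDerivAt_id (0 : ℝ)).const_mul 2).const_mul a₂).add
    (((hasDerivAt_pow 3 (0 : ℝ)).const_mul 4).const_mul a₄)).add
    (((hasDerivAt_pow 5 (0 : ℝ)).const_mul 6).const_mul a₆)).deriv.trans (by norm_num; ring)

/-- The integrand of `v ↦ ½ ⟨Λ_c''(u₀) iv, iv⟩` for real `v`, where `p, q` are the values of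
`u₀, u₀'` and `v, v₁, v₂` those of the perturbation and its derivatives. -/
noncomputable def imaginaryDensity (ℰ c p q v v₁ v₂ : ℝ) : ℝ :=
  v₂ ^ 2 + 3 * p ^ 2 * v₁ ^ 2 + 3 * q ^ 2 * v ^ 2 + 4 * p * q * v * v₁ + 3 / 2 * p ^ 4 * v ^ 2
    - 1 / 2 * (3 - ℰ ^ 2) * v ^ 2 - c * (v₁ ^ 2 - (1 - p ^ 2) * v ^ 2)

theorem secondVariationDensity_I_mul (ℰ c x v v₁ v₂ : ℝ) :
    secondVariationDensity ℰ c x (Complex.I * v) (Complex.I * v₁) (Complex.I * v₂)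
      (Complex.I * v) (Complex.I * v₁) (Complex.I * v₂) =
    2 * imaginaryDensity ℰ c (profile ℰ x) (deriv (profile ℰ) x) v v₁ v₂ := by
  have hmk : ∀ p s v : ℝ, (p : ℂ) + s * (Complex.I * v) = ⟨p, s * v⟩ := fun p s v => by
    apply Complex.ext <;> simp
  simp only [secondVariationDensity_self, hmk, lambdaDensity_mk]
  generalize profile ℰ x = p
  generalize deriv (profile ℰ) x = q
  generalize deriv (deriv (profile ℰ)) x = r
  rw [← deriv_deriv_even_sextic (r ^ 2 + 3 * p ^ 2 * q ^ 2 + 2 * (p * q) ^ 2 + 1 / 2 * p ^ 6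
      - 1 / 2 * (3 - ℰ ^ 2) * p ^ 2 - c * (q ^ 2 + 1 / 2 * (1 - p ^ 2) ^ 2)) _
      (3 * v ^ 2 * v₁ ^ 2 + 2 * (v * v₁) ^ 2 + 3 / 2 * p ^ 2 * v ^ 4 - c * (1 / 2 * v ^ 4))
      (1 / 2 * v ^ 6)]
  congr 2
  funext s
  rw [imaginaryDensity]
  ring

theorem secondVariation_I_mul (ℰ c : ℝ) (v v₁ v₂ : ℝ → ℝ) :
    secondVariation ℰ c (fun x => Complex.I * v x) (fun x => Complex.I * v₁ x)
      (fun x => Complex.I * v₂ x) (fun x => Complex.I * v x) (fun x => Complex.I * v₁ x)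
      (fun x => Complex.I * v₂ x) =
    2 * ∫ x, imaginaryDensity ℰ c (profile ℰ x) (deriv (profile ℰ) x) (v x) (v₁ x) (v₂ x) := by
  simp only [secondVariation, secondVariationDensity_I_mul, integral_const_mul]

end ImaginaryDirection

section CompactSupport

theorem tsupport_subset_of_hasDerivAt {E : Type*} [NormedAddCommGroup E] [NormedSpace ℝ E]
    {f f' : ℝ → E} (h : ∀ x, HasDerivAt f (f' x) x) : tsupport f' ⊆ tsupport f := by
  rw [← funext fun x => (h x).deriv]
  exact tsupport_deriv_subset

theorem hasWeakDeriv_of_hasDerivAt {f g : ℝ → ℂ} (hf : ∀ x, HasDerivAt f (g x) x)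
    (hg : Continuous g) : HasWeakDeriv f g := by
  intro η hη hηc
  have hη' : ∀ x, HasDerivAt η (deriv η x) x := fun x =>
    (hη.differentiable (by simp) x).hasDerivAt
  have hint : ∀ {ζ : ℝ → ℝ} {u : ℝ → ℂ}, Continuous ζ → HasCompactSupport ζ → Continuous u →
      Integrable fun x => ζ x • u x :=
    fun hζ hζc hu => (hζ.smul hu).integrable_of_hasCompactSupport hζc.smul_right
  have hfc := continuous_of_hasDerivAt hf
  have hηg := hint hη.continuous hηc hg
  have hη'f := hint (hη.continuous_deriv (by simp)) hηc.deriv hfc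
  have hzero := integral_eq_zero_of_hasDerivAt_of_integrable (fun x => (hη' x).smul (hf x))
    (hηg.add hη'f) (hint hη.continuous hηc hfc)
  rw [integral_add hηg hη'f] at hzero
  exact eq_neg_of_add_eq_zero_right hzero

theorem memH2_of_hasCompactSupport {φ φ₁ φ₂ : ℝ → ℂ} (h : ∀ x, HasDerivAt φ (φ₁ x) x)
    (h₁ : ∀ x, HasDerivAt φ₁ (φ₂ x) x) (h₂ : Continuous φ₂) (hφ : HasCompactSupport φ) :
    MemH2 φ φ₁ φ₂ := by
  have hφ₁ : HasCompactSupport φ₁ := hφ.mono' (subset_closure.trans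
    (tsupport_subset_of_hasDerivAt h))
  have hφ₂ : HasCompactSupport φ₂ := hφ₁.mono' (subset_closure.trans
    (tsupport_subset_of_hasDerivAt h₁))
  have hφ₁c := continuous_of_hasDerivAt h₁
  exact
    { memLp := (continuous_of_hasDerivAt h).memLp_of_hasCompactSupport hφ
      memLp₁ := hφ₁c.memLp_of_hasCompactSupport hφ₁
      memLp₂ := h₂.memLp_of_hasCompactSupport hφ₂
      weakDeriv₁ := hasWeakDeriv_of_hasDerivAt h hφ₁c
      weakDeriv₂ := hasWeakDeriv_of_hasDerivAt h₁ h₂ }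

theorem integral_deriv_sq_pos {F : ℝ → ℝ} (hF : ContDiff ℝ 1 F) (hFc : HasCompactSupport F)
    {x₀ : ℝ} (hx₀ : F x₀ ≠ 0) : 0 < ∫ y, deriv F y ^ 2 := by
  obtain ⟨x₁, hx₁⟩ := (Set.ne_univ_iff_exists_notMem _).1 hFc.isCompact.ne_univ
  have hFx₁ : F x₁ = 0 := image_eq_zero_of_notMem_tsupport hx₁
  obtain ⟨y, hy⟩ : ∃ y, deriv F y ≠ 0 := by
    by_contra! hzero
    exact hx₀ ((is_const_of_deriv_eq_zero (hF.differentiable one_ne_zero) hzero x₀ x₁).trans hFx₁)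
  have hcont : Continuous fun y => deriv F y ^ 2 := (hF.continuous_deriv le_rfl).pow 2
  have hsupp : HasCompactSupport fun y => deriv F y ^ 2 :=
    hFc.deriv.comp_left (g := fun r : ℝ => r ^ 2) (by simp)
  exact hcont.integral_pos_of_hasCompactSupport_nonneg_nonzero hsupp (fun y => sq_nonneg _)
    (pow_ne_zero 2 hy)

end CompactSupport

/-- The first integral of the profile makes the two densities differ by an exact derivative. -/
theorem IsWave.integral_imaginaryDensity {ℰ : ℝ} {p q v v₁ v₂ : ℝ → ℝ} (hp : IsWave ℰ p q) (c : ℝ)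
    (h : ∀ x, HasDerivAt v (v₁ x) x) (h₁ : ∀ x, HasDerivAt v₁ (v₂ x) x) (h₂ : Continuous v₂)
    (hv : HasCompactSupport v) :
    ∫ x, imaginaryDensity ℰ c (p x) (q x) (v x) (v₁ x) (v₂ x) =
      ∫ x, ((v₂ x + (1 - p x ^ 2) * v x) ^ 2 + (p x * v₁ x - q x * v x) ^ 2
        + (c - 2) * v x * (v₂ x + (1 - p x ^ 2) * v x)) := by
  have hpc := hp.continuous
  have hqc := hp.continuous_deriv
  have hvc := continuous_of_hasDerivAt h
  have hv₁c := continuous_of_hasDerivAt h₁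
  have hzero : ∀ x ∉ tsupport v, v x = 0 ∧ v₁ x = 0 ∧ v₂ x = 0 := fun x hx =>
    have hx₁ := fun hmem => hx (tsupport_subset_of_hasDerivAt h hmem)
    ⟨image_eq_zero_of_notMem_tsupport hx, image_eq_zero_of_notMem_tsupport hx₁,
      image_eq_zero_of_notMem_tsupport fun hmem => hx₁ (tsupport_subset_of_hasDerivAt h₁ hmem)⟩
  have hint : ∀ {f : ℝ → ℝ}, Continuous f → (∀ x, v x = 0 ∧ v₁ x = 0 ∧ v₂ x = 0 → f x = 0) →
      Integrable f := fun hf hfz =>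
    hf.integrable_of_hasCompactSupport (HasCompactSupport.intro hv fun x hx => hfz x (hzero x hx))
  have hflux : ∀ x, HasDerivAt
      (fun x => p x * q x * v x ^ 2 - (c - 2 * p x ^ 2) * (v x * v₁ x))
      (imaginaryDensity ℰ c (p x) (q x) (v x) (v₁ x) (v₂ x)
        - ((v₂ x + (1 - p x ^ 2) * v x) ^ 2 + (p x * v₁ x - q x * v x) ^ 2
          + (c - 2) * v x * (v₂ x + (1 - p x ^ 2) * v x))) x := fun x => by
    have hpx := hp.hasDerivAt x
    refine (((hpx.mul (hp.hasDerivAt_deriv x)).mul ((h x).pow 2)).sub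
      ((((hpx.pow 2).const_mul 2).const_sub c).mul ((h x).mul (h₁ x)))).congr_deriv ?_
    simp only [imaginaryDensity, Pi.mul_apply, Pi.pow_apply, Nat.cast_ofNat, Nat.reduceSub, pow_one]
    linear_combination (-v x ^ 2) * hp.sq_deriv x
  have hdens := hint (f := fun x => imaginaryDensity ℰ c (p x) (q x) (v x) (v₁ x) (v₂ x))
    (by unfold imaginaryDensity; fun_prop) fun x ⟨e, e₁, e₂⟩ => by
      simp [imaginaryDensity, e, e₁, e₂]
  have hsq := hint (f := fun x => (v₂ x + (1 - p x ^ 2) * v x) ^ 2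
      + (p x * v₁ x - q x * v x) ^ 2 + (c - 2) * v x * (v₂ x + (1 - p x ^ 2) * v x))
    (by fun_prop) fun x ⟨e, e₁, e₂⟩ => by simp [e, e₁, e₂]
  have hzero_int := integral_eq_zero_of_hasDerivAt_of_integrable hflux (hdens.sub hsq)
    (hint (by fun_prop) fun x ⟨e, _, _⟩ => by simp [e])
  rwa [integral_sub hdens hsq, sub_eq_zero] at hzero_int

theorem integral_sq_add_sq_nonneg {ℰ c : ℝ} (hℰ : ℰ ∈ Set.Ioo (0 : ℝ) 1)
    (hpos : ∀ φ φ₁ φ₂ : ℝ → ℂ, MemH2 φ φ₁ φ₂ → 0 ≤ secondVariation ℰ c φ φ₁ φ₂ φ φ₁ φ₂)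
    {v v₁ v₂ : ℝ → ℝ} (h : ∀ x, HasDerivAt v (v₁ x) x) (h₁ : ∀ x, HasDerivAt v₁ (v₂ x) x)
    (h₂ : Continuous v₂) (hv : HasCompactSupport v) :
    0 ≤ ∫ x, ((v₂ x + (1 - profile ℰ x ^ 2) * v x) ^ 2
        + (profile ℰ x * v₁ x - deriv (profile ℰ) x * v x) ^ 2
        + (c - 2) * v x * (v₂ x + (1 - profile ℰ x ^ 2) * v x)) := by
  have hmem : MemH2 (fun x => Complex.I * v x) (fun x => Complex.I * v₁ x)
      (fun x => Complex.I * v₂ x) :=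
    memH2_of_hasCompactSupport (fun x => (h x).ofReal_comp.const_mul _)
      (fun x => (h₁ x).ofReal_comp.const_mul _) (by fun_prop)
      (hv.comp_left (g := fun r : ℝ => Complex.I * r) (by simp))
  have hnonneg := hpos _ _ _ hmem
  rw [secondVariation_I_mul, (isWave_profile hℰ).integral_imaginaryDensity c h h₁ h₂ hv] at hnonneg
  exact nonneg_of_mul_nonneg_right hnonneg two_pos

section SlowModulation

/-- The derivative `a (p² + a)`, at a point where `u₀` has the value `p`, of the phase in which the
perturbation is modulated. -/
def phaseSpeed (a p : ℝ) : ℝ :=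
  a * (p ^ 2 + a)

/-- The value of the trial function `v = G(θ) u₀ - 2a G'(θ) u₀'`, where `θ' = phaseSpeed a u₀`. Here
and in the next four definitions `g₀, g₁, g₂, g₃` are the values at `θ` of `G` and its
derivatives, and `p, q` are those of `u₀, u₀'`. -/
def trial (a g₀ g₁ p q : ℝ) : ℝ :=
  g₀ * p - 2 * a * g₁ * q

/-- The derivative `v'` of the trial function. -/
def trialDeriv (a g₀ g₁ g₂ p q : ℝ) : ℝ :=
  g₀ * q + a * g₁ * p * (2 + a - p ^ 2) - 2 * a * phaseSpeed a p * g₂ * q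

/-- The defect `v'' + (1 - u₀²) v` of the trial function in the equation satisfied by `u₀`. -/
def trialDefect (a g₁ g₂ g₃ p q : ℝ) : ℝ :=
  2 * a ^ 2 * g₁ * q + a ^ 2 * g₂ * p * (4 * a - a ^ 2 + 8 * p ^ 2 - 2 * a * p ^ 2 - 5 * p ^ 4)
    - 2 * a * phaseSpeed a p ^ 2 * g₃ * q

/-- The Wronskian `u₀ v' - u₀' v` of the profile and the trial function. -/
def trialWronskian (a g₁ g₂ p q : ℝ) : ℝ :=
  a * phaseSpeed a p * (g₁ - 2 * g₂ * p * q)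

/-- The integrand of `½ ⟨Λ_c''(u₀) iv, iv⟩` for the trial function `v`, up to an exact derivative
that removes `G(θ)` itself. -/
def trialDensity (a c g₁ g₂ g₃ p q : ℝ) : ℝ :=
  trialDefect a g₁ g₂ g₃ p q ^ 2 + trialWronskian a g₁ g₂ p q ^ 2
    - (c - 2) * g₁ * (phaseSpeed a p * trialWronskian a g₁ g₂ p q
      + 2 * a * q * trialDefect a g₁ g₂ g₃ p q)

variable {ℰ a : ℝ} {p q g₀ g₁ g₂ g₃ : ℝ → ℝ}

theorem IsWave.hasDerivAt_trial (hp : IsWave ℰ p q) {x : ℝ}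
    (h₀ : HasDerivAt g₀ (phaseSpeed a (p x) * g₁ x) x)
    (h₁ : HasDerivAt g₁ (phaseSpeed a (p x) * g₂ x) x) :
    HasDerivAt (fun x => trial a (g₀ x) (g₁ x) (p x) (q x))
      (trialDeriv a (g₀ x) (g₁ x) (g₂ x) (p x) (q x)) x := by
  refine ((h₀.mul (hp.hasDerivAt x)).sub
    ((h₁.const_mul (2 * a)).mul (hp.hasDerivAt_deriv x))).congr_deriv ?_
  simp only [trialDeriv, phaseSpeed]
  ring

theorem IsWave.hasDerivAt_trialDeriv (hp : IsWave ℰ p q) (ha : a ^ 2 = 1 - ℰ ^ 2) {x : ℝ}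
    (h₀ : HasDerivAt g₀ (phaseSpeed a (p x) * g₁ x) x)
    (h₁ : HasDerivAt g₁ (phaseSpeed a (p x) * g₂ x) x)
    (h₂ : HasDerivAt g₂ (phaseSpeed a (p x) * g₃ x) x) :
    HasDerivAt (fun x => trialDeriv a (g₀ x) (g₁ x) (g₂ x) (p x) (q x))
      (trialDefect a (g₁ x) (g₂ x) (g₃ x) (p x) (q x)
        - (1 - p x ^ 2) * trial a (g₀ x) (g₁ x) (p x) (q x)) x := by
  have hpx := hp.hasDerivAt x
  have hqx := hp.hasDerivAt_deriv x
  have hspeed : HasDerivAt (fun x => 2 * a * phaseSpeed a (p x))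
      (2 * a * (a * (2 * p x * q x))) x :=
    ((((hpx.pow 2).add_const a).const_mul a).const_mul (2 * a)).congr_deriv (by norm_num)
  refine (((h₀.mul hqx).add (((h₁.const_mul a).mul hpx).mul ((hpx.pow 2).const_sub (2 + a)))).sub
    ((hspeed.mul h₂).mul hqx)).congr_deriv ?_
  simp only [trial, trialDefect, phaseSpeed, Pi.pow_apply, Pi.mul_apply, Nat.cast_ofNat,
    Nat.reduceSub, pow_one]
  linear_combination (-4 * a ^ 2 * p x * g₂ x) * hp.sq_deriv x + 2 * a ^ 2 * p x * g₂ x * ha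

theorem IsWave.mul_trialDeriv_sub (hp : IsWave ℰ p q) (ha : a ^ 2 = 1 - ℰ ^ 2) (g₀ g₁ g₂ x : ℝ) :
    p x * trialDeriv a g₀ g₁ g₂ (p x) (q x) - q x * trial a g₀ g₁ (p x) (q x) =
      trialWronskian a g₁ g₂ (p x) (q x) := by
  simp only [trial, trialDeriv, trialWronskian, phaseSpeed]
  linear_combination (2 * a * g₁) * hp.sq_deriv x - a * g₁ * ha

theorem IsWave.hasDerivAt_trialWronskian (hp : IsWave ℰ p q) (ha : a ^ 2 = 1 - ℰ ^ 2) {x : ℝ}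
    (h₁ : HasDerivAt g₁ (phaseSpeed a (p x) * g₂ x) x)
    (h₂ : HasDerivAt g₂ (phaseSpeed a (p x) * g₃ x) x) :
    HasDerivAt (fun x => trialWronskian a (g₁ x) (g₂ x) (p x) (q x))
      (p x * trialDefect a (g₁ x) (g₂ x) (g₃ x) (p x) (q x)) x := by
  have hpx := hp.hasDerivAt x
  have hqx := hp.hasDerivAt_deriv x
  have hspeed : HasDerivAt (fun x => a * phaseSpeed a (p x)) (a * (a * (2 * p x * q x))) x :=
    ((((hpx.pow 2).add_const a).const_mul a).const_mul a).congr_deriv (by norm_num)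
  refine (hspeed.mul (h₁.sub (((h₂.const_mul 2).mul hpx).mul hqx))).congr_deriv ?_
  simp only [trialDefect, phaseSpeed, Pi.mul_apply, Pi.sub_apply]
  linear_combination (-2 * a ^ 2 * (3 * p x ^ 2 + a) * g₂ x) * hp.sq_deriv x
    + a ^ 2 * (3 * p x ^ 2 + a) * g₂ x * ha

theorem IsWave.integral_trialDensity (hp : IsWave ℰ p q) (ha : a ^ 2 = 1 - ℰ ^ 2) (c : ℝ)
    (h₀ : ∀ x, HasDerivAt g₀ (phaseSpeed a (p x) * g₁ x) x)
    (h₁ : ∀ x, HasDerivAt g₁ (phaseSpeed a (p x) * g₂ x) x)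
    (h₂ : ∀ x, HasDerivAt g₂ (phaseSpeed a (p x) * g₃ x) x) (h₃ : Continuous g₃)
    {x₁ x₂ : ℝ} (hx₁ : g₀ x₁ = 0) (hx₂ : g₀ x₂ = 0) :
    ∫ x in x₁..x₂, (trialDefect a (g₁ x) (g₂ x) (g₃ x) (p x) (q x) ^ 2
        + trialWronskian a (g₁ x) (g₂ x) (p x) (q x) ^ 2
        + (c - 2) * trial a (g₀ x) (g₁ x) (p x) (q x)
          * trialDefect a (g₁ x) (g₂ x) (g₃ x) (p x) (q x)) =
      ∫ x in x₁..x₂, trialDensity a c (g₁ x) (g₂ x) (g₃ x) (p x) (q x) := by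
  have hpc := hp.continuous
  have hqc := hp.continuous_deriv
  have hg₀ := continuous_of_hasDerivAt h₀
  have hg₁ := continuous_of_hasDerivAt h₁
  have hg₂ := continuous_of_hasDerivAt h₂
  have hflux : ∀ x, HasDerivAt
      (fun x => (c - 2) * (g₀ x * trialWronskian a (g₁ x) (g₂ x) (p x) (q x)))
      ((trialDefect a (g₁ x) (g₂ x) (g₃ x) (p x) (q x) ^ 2
        + trialWronskian a (g₁ x) (g₂ x) (p x) (q x) ^ 2
        + (c - 2) * trial a (g₀ x) (g₁ x) (p x) (q x)
          * trialDefect a (g₁ x) (g₂ x) (g₃ x) (p x) (q x))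
        - trialDensity a c (g₁ x) (g₂ x) (g₃ x) (p x) (q x)) x := fun x => by
    refine (((h₀ x).mul (hp.hasDerivAt_trialWronskian ha (h₁ x) (h₂ x))).const_mul
      (c - 2)).congr_deriv ?_
    rw [trialDensity, trial]
    ring
  have hform : Continuous fun x => trialDefect a (g₁ x) (g₂ x) (g₃ x) (p x) (q x) ^ 2
      + trialWronskian a (g₁ x) (g₂ x) (p x) (q x) ^ 2
      + (c - 2) * trial a (g₀ x) (g₁ x) (p x) (q x)
        * trialDefect a (g₁ x) (g₂ x) (g₃ x) (p x) (q x) := by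
    unfold trialDefect trialWronskian trial phaseSpeed
    fun_prop
  have hdens : Continuous fun x => trialDensity a c (g₁ x) (g₂ x) (g₃ x) (p x) (q x) := by
    unfold trialDensity trialDefect trialWronskian phaseSpeed
    fun_prop
  have hzero := intervalIntegral.integral_eq_sub_of_hasDerivAt (fun x _ => hflux x)
    ((hform.sub hdens).intervalIntegrable x₁ x₂)
  rw [intervalIntegral.integral_sub (hform.intervalIntegrable _ _)
    (hdens.intervalIntegrable _ _)] at hzero
  simpa [hx₁, hx₂, sub_eq_zero] using hzero

theorem integral_trialDensity_nonneg {c L : ℝ} (hℰ : ℰ ∈ Set.Ioo (0 : ℝ) 1)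
    (ha : a ^ 2 = 1 - ℰ ^ 2)
    (hpos : ∀ φ φ₁ φ₂ : ℝ → ℂ, MemH2 φ φ₁ φ₂ → 0 ≤ secondVariation ℰ c φ φ₁ φ₂ φ φ₁ φ₂)
    (h₀ : ∀ x, HasDerivAt g₀ (phaseSpeed a (profile ℰ x) * g₁ x) x)
    (h₁ : ∀ x, HasDerivAt g₁ (phaseSpeed a (profile ℰ x) * g₂ x) x)
    (h₂ : ∀ x, HasDerivAt g₂ (phaseSpeed a (profile ℰ x) * g₃ x) x) (h₃ : Continuous g₃)
    (hL : ∀ x, L ≤ |x| → g₀ x = 0 ∧ g₁ x = 0 ∧ g₂ x = 0 ∧ g₃ x = 0) :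
    0 ≤ ∫ x in -L..L,
      trialDensity a c (g₁ x) (g₂ x) (g₃ x) (profile ℰ x) (deriv (profile ℰ) x) := by
  have hp := isWave_profile hℰ
  have hpc := hp.continuous
  have hqc := hp.continuous_deriv
  have hg₀ := continuous_of_hasDerivAt h₀
  have hg₁ := continuous_of_hasDerivAt h₁
  have hg₂ := continuous_of_hasDerivAt h₂
  have hcont : Continuous fun x =>
      trialDefect a (g₁ x) (g₂ x) (g₃ x) (profile ℰ x) (deriv (profile ℰ) x)
        - (1 - profile ℰ x ^ 2)
          * trial a (g₀ x) (g₁ x) (profile ℰ x) (deriv (profile ℰ) x) := by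
    unfold trialDefect trial phaseSpeed
    fun_prop
  have hsupp : HasCompactSupport fun x =>
      trial a (g₀ x) (g₁ x) (profile ℰ x) (deriv (profile ℰ) x) := by
    refine HasCompactSupport.intro (isCompact_Icc (a := -L) (b := L)) fun x hx => ?_
    rw [Set.mem_Icc, ← abs_le, not_le] at hx
    simp [trial, hL x hx.le]
  have hnonneg := integral_sq_add_sq_nonneg hℰ hpos
    (fun x => hp.hasDerivAt_trial (h₀ x) (h₁ x))
    (fun x => hp.hasDerivAt_trialDeriv ha (h₀ x) (h₁ x) (h₂ x)) hcont hsupp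
  simp only [sub_add_cancel, hp.mul_trialDeriv_sub ha] at hnonneg
  rw [← hp.integral_trialDensity ha c h₀ h₁ h₂ h₃ (hL (-L) (by simp [le_abs_self])).1
    (hL L (le_abs_self L)).1, intervalIntegral.integral_eq_integral_of_support_subset]
  · exact hnonneg
  · refine fun x hx => Set.Ioo_subset_Ioc_self (abs_lt.1 ?_)
    by_contra! hxL
    exact hx (by simp [trialDefect, trialWronskian, hL x hxL])

theorem exists_abs_trialDensity_sub_le (a c M₁ M₂ M₃ : ℝ) :
    ∃ C, ∀ ε ∈ Set.Icc (0 : ℝ) 1, ∀ g₁ g₂ g₃ p q : ℝ,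
      |g₁| ≤ M₁ → |g₂| ≤ M₂ → |g₃| ≤ M₃ → |p| ≤ 1 → |q| ≤ 1 →
      |trialDensity a c (ε * g₁) (ε ^ 2 * g₂) (ε ^ 3 * g₃) p q
        - ε ^ 2 * (a * (2 + a - c) * (phaseSpeed a p ^ 2 + 4 * a ^ 2 * q ^ 2) * g₁ ^ 2)|
        ≤ ε ^ 3 * C := by
  let defectTail : ℝ → ℝ → ℝ → ℝ → ℝ → ℝ := fun ε g₂ g₃ p q =>
    a ^ 2 * g₂ * p * (4 * a - a ^ 2 + 8 * p ^ 2 - 2 * a * p ^ 2 - 5 * p ^ 4)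
      - ε * (2 * a * phaseSpeed a p ^ 2 * g₃ * q)
  let wronskianTail : ℝ → ℝ → ℝ → ℝ := fun g₂ p q => -(2 * a * phaseSpeed a p * g₂ * p * q)
  let remainder : ℝ × ℝ × ℝ × ℝ × ℝ × ℝ → ℝ := fun ⟨ε, g₁, g₂, g₃, p, q⟩ =>
    g₁ * ((4 * a ^ 2 - 2 * a * (c - 2)) * q * defectTail ε g₂ g₃ p q
        + (2 * a - (c - 2)) * phaseSpeed a p * wronskianTail g₂ p q)
      + ε * (defectTail ε g₂ g₃ p q ^ 2 + wronskianTail g₂ p q ^ 2)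
  have hcont : Continuous remainder := by
    simp only [remainder, defectTail, wronskianTail, phaseSpeed]
    fun_prop
  have hcompact : IsCompact (Set.Icc (0 : ℝ) 1 ×ˢ Set.Icc (-M₁) M₁ ×ˢ Set.Icc (-M₂) M₂ ×ˢ
      Set.Icc (-M₃) M₃ ×ˢ Set.Icc (-1 : ℝ) 1 ×ˢ Set.Icc (-1 : ℝ) 1) :=
    isCompact_Icc.prod (isCompact_Icc.prod (isCompact_Icc.prod (isCompact_Icc.prod
      (isCompact_Icc.prod isCompact_Icc))))
  obtain ⟨C, hC⟩ := hcompact.exists_bound_of_continuousOn hcont.continuousOn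
  refine ⟨C, fun ε hε g₁ g₂ g₃ p q h₁ h₂ h₃ hp hq => ?_⟩
  have hexpand : trialDensity a c (ε * g₁) (ε ^ 2 * g₂) (ε ^ 3 * g₃) p q
      - ε ^ 2 * (a * (2 + a - c) * (phaseSpeed a p ^ 2 + 4 * a ^ 2 * q ^ 2) * g₁ ^ 2)
      = ε ^ 3 * remainder (ε, g₁, g₂, g₃, p, q) := by
    simp only [trialDensity, trialDefect, trialWronskian, remainder, defectTail, wronskianTail]
    ring
  rw [hexpand, abs_mul, abs_of_nonneg (pow_nonneg hε.1 3)]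
  exact mul_le_mul_of_nonneg_left (hC (ε, g₁, g₂, g₃, p, q) ⟨hε, abs_le.1 h₁, abs_le.1 h₂,
    abs_le.1 h₃, abs_le.1 hp, abs_le.1 hq⟩) (pow_nonneg hε.1 3)

end SlowModulation

section Phase

/-- The phase `θ` of the modulation, with `θ' = phaseSpeed a u₀`, normalized by `θ(0) = 0`. -/
noncomputable def phase (a : ℝ) (p : ℝ → ℝ) (x : ℝ) : ℝ :=
  ∫ y in (0 : ℝ)..x, phaseSpeed a (p y)

/-- The `j`-th derivative of `F(εθ(x))` with respect to the phase `θ(x)`. -/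
noncomputable def slowDeriv (F θ : ℝ → ℝ) (ε : ℝ) (j : ℕ) (x : ℝ) : ℝ :=
  ε ^ j * iteratedDeriv j F (ε * θ x)

variable {a δ ε w R x : ℝ} {p F θ : ℝ → ℝ}

theorem hasDerivAt_phase (hp : Continuous p) (x : ℝ) :
    HasDerivAt (phase a p) (phaseSpeed a (p x)) x := by
  have hcont : Continuous fun y => phaseSpeed a (p y) := by
    unfold phaseSpeed
    fun_prop
  exact (hcont.integral_hasStrictDerivAt 0 x).hasDerivAt

theorem mul_sub_le_phase_sub (hp : Continuous p) (hspeed : ∀ y, δ ≤ phaseSpeed a (p y))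
    {x₁ x₂ : ℝ} (hx : x₁ ≤ x₂) : δ * (x₂ - x₁) ≤ phase a p x₂ - phase a p x₁ :=
  mul_sub_le_image_sub_of_le_deriv (fun z => (hasDerivAt_phase hp z).differentiableAt)
    (fun z => (hasDerivAt_phase hp z).deriv ▸ hspeed z) hx

theorem phase_zero (a : ℝ) (p : ℝ → ℝ) : phase a p 0 = 0 :=
  intervalIntegral.integral_same

theorem le_mul_phase (hp : Continuous p) (hδ : 0 < δ) (hspeed : ∀ y, δ ≤ phaseSpeed a (p y))
    (hε : 0 < ε) (hx : R / (ε * δ) ≤ x) (hx₀ : 0 ≤ x) : R ≤ ε * phase a p x := by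
  have hgrowth := mul_sub_le_phase_sub hp hspeed hx₀
  rw [phase_zero, sub_zero, sub_zero] at hgrowth
  calc R ≤ ε * (δ * x) := by rwa [← mul_assoc, mul_comm, ← div_le_iff₀ (mul_pos hε hδ)]
    _ ≤ ε * phase a p x := by gcongr

theorem mul_phase_le_neg (hp : Continuous p) (hδ : 0 < δ) (hspeed : ∀ y, δ ≤ phaseSpeed a (p y))
    (hε : 0 < ε) (hx : x ≤ -(R / (ε * δ))) (hx₀ : x ≤ 0) : ε * phase a p x ≤ -R := by
  have hgrowth := mul_sub_le_phase_sub hp hspeed hx₀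
  rw [phase_zero, zero_sub, zero_sub] at hgrowth
  have hR : R ≤ ε * (δ * -x) := by
    rw [← mul_assoc, mul_comm, ← div_le_iff₀ (mul_pos hε hδ)]
    exact le_neg_of_le_neg hx
  linarith [mul_le_mul_of_nonneg_left hgrowth hε.le]

theorem le_abs_mul_phase (hp : Continuous p) (hδ : 0 < δ) (hspeed : ∀ y, δ ≤ phaseSpeed a (p y))
    (hε : 0 < ε) (hx : R / (ε * δ) ≤ |x|) : R ≤ |ε * phase a p x| := by
  rcases le_total 0 x with hx₀ | hx₀
  · rw [abs_of_nonneg hx₀] at hx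
    exact le_abs.2 (.inl (le_mul_phase hp hδ hspeed hε hx hx₀))
  · rw [abs_of_nonpos hx₀] at hx
    exact le_abs.2 (.inr (le_neg_of_le_neg
      (mul_phase_le_neg hp hδ hspeed hε (le_neg_of_le_neg hx) hx₀)))

theorem hasDerivAt_slowDeriv (hF : ContDiff ℝ ∞ F) (hθ : HasDerivAt θ w x) (j : ℕ) :
    HasDerivAt (slowDeriv F θ ε j) (w * slowDeriv F θ ε (j + 1) x) x := by
  have hj : HasDerivAt (iteratedDeriv j F) (iteratedDeriv (j + 1) F (ε * θ x)) (ε * θ x) := by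
    rw [iteratedDeriv_succ]
    exact (hF.differentiable_iteratedDeriv j (mod_cast WithTop.coe_lt_top j) _).hasDerivAt
  refine ((hj.comp x (hθ.const_mul ε)).const_mul (ε ^ j)).congr_deriv ?_
  rw [slowDeriv]
  ring

theorem tsupport_iteratedDeriv_subset {𝕜 E : Type*} [NontriviallyNormedField 𝕜]
    [NormedAddCommGroup E] [NormedSpace 𝕜 E] (f : 𝕜 → E) (j : ℕ) :
    tsupport (iteratedDeriv j f) ⊆ tsupport f := by
  refine closure_minimal (fun y hy => ?_) (isClosed_tsupport f)
  refine support_iteratedFDeriv_subset (𝕜 := 𝕜) j fun hzero => hy ?_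
  rw [iteratedDeriv_eq_iteratedFDeriv, hzero, zero_apply]

theorem slowDeriv_eq_zero (hF : tsupport F ⊆ Metric.ball 0 R) (h : R ≤ |ε * θ x|) (j : ℕ) :
    slowDeriv F θ ε j x = 0 := by
  have hnot : ε * θ x ∉ tsupport (iteratedDeriv j F) := fun hmem =>
    h.not_gt (by simpa using hF (tsupport_iteratedDeriv_subset F j hmem))
  rw [slowDeriv, image_eq_zero_of_notMem_tsupport hnot, mul_zero]

theorem exists_abs_iteratedDeriv_le (hF : ContDiff ℝ ∞ F) (hFc : HasCompactSupport F) (j : ℕ) :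
    ∃ M, ∀ y, |iteratedDeriv j F y| ≤ M :=
  have hsupp : HasCompactSupport (iteratedDeriv j F) :=
    hFc.mono' (subset_closure.trans (tsupport_iteratedDeriv_subset F j))
  hsupp.exists_bound_of_continuous (hF.continuous_iteratedDeriv j (mod_cast le_top))

theorem integral_comp_mul_deriv_eq_integral {f θ θ' : ℝ → ℝ} {x₁ x₂ : ℝ} (hf : Continuous f)
    (hθ : ∀ x, HasDerivAt θ (θ' x) x) (hθ' : Continuous θ')
    (hsupp : Function.support f ⊆ Set.Ioc (θ x₁) (θ x₂)) :
    ∫ x in x₁..x₂, f (θ x) * θ' x = ∫ y, f y := by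
  rw [← intervalIntegral.integral_eq_integral_of_support_subset hsupp]
  exact intervalIntegral.integral_comp_mul_deriv (fun x _ => hθ x) hθ'.continuousOn hf

end Phase

section Slope

variable {ℰ a c δ ε R : ℝ} {F : ℝ → ℝ}

theorem integral_slowDeriv_one_sq {p : ℝ → ℝ} (hp : Continuous p) (hδ : 0 < δ)
    (hspeed : ∀ x, δ ≤ phaseSpeed a (p x)) (hF : ContDiff ℝ 1 F)
    (hFR : tsupport F ⊆ Metric.ball 0 R) (hR : 0 < R) (hε : 0 < ε) :
    ∫ x in -(R / (ε * δ))..R / (ε * δ),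
      phaseSpeed a (p x) * slowDeriv F (phase a p) ε 1 x ^ 2 = ε * ∫ y, deriv F y ^ 2 := by
  have hL : 0 ≤ R / (ε * δ) := by positivity
  have hsupp : (Function.support fun y => deriv F y ^ 2) ⊆
      Set.Ioc (ε * phase a p (-(R / (ε * δ)))) (ε * phase a p (R / (ε * δ))) := fun y hy => by
    have hball : |y| < R := by
      simpa using hFR (tsupport_deriv_subset (subset_closure fun h => hy (by simp [h])))
    exact ⟨(mul_phase_le_neg hp hδ hspeed hε le_rfl (neg_nonpos.2 hL)).trans_lt (abs_lt.1 hball).1,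
      (abs_lt.1 hball).2.le.trans (le_mul_phase hp hδ hspeed hε le_rfl hL)⟩
  have hcont : Continuous fun y => deriv F y ^ 2 := (hF.continuous_deriv le_rfl).pow 2
  rw [← integral_comp_mul_deriv_eq_integral hcont (fun x => (hasDerivAt_phase hp x).const_mul ε)
    (by unfold phaseSpeed; fun_prop) hsupp,
    ← intervalIntegral.integral_const_mul]
  simp only [slowDeriv, iteratedDeriv_one]
  congr 1
  funext x
  ring

theorem integral_trialDensity_slowDeriv_nonneg (hℰ : ℰ ∈ Set.Ioo (0 : ℝ) 1)
    (ha : a ^ 2 = 1 - ℰ ^ 2) (hδ : 0 < δ) (hspeed : ∀ x, δ ≤ phaseSpeed a (profile ℰ x))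
    (hpos : ∀ φ φ₁ φ₂ : ℝ → ℂ, MemH2 φ φ₁ φ₂ → 0 ≤ secondVariation ℰ c φ φ₁ φ₂ φ φ₁ φ₂)
    (hF : ContDiff ℝ ∞ F) (hFR : tsupport F ⊆ Metric.ball 0 R) (hε : 0 < ε) :
    0 ≤ ∫ x in -(R / (ε * δ))..R / (ε * δ),
      trialDensity a c (slowDeriv F (phase a (profile ℰ)) ε 1 x)
        (slowDeriv F (phase a (profile ℰ)) ε 2 x) (slowDeriv F (phase a (profile ℰ)) ε 3 x)
        (profile ℰ x) (deriv (profile ℰ) x) := by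
  have hp := (isWave_profile hℰ).continuous
  have hderiv : ∀ j x, HasDerivAt (slowDeriv F (phase a (profile ℰ)) ε j)
      (phaseSpeed a (profile ℰ x) * slowDeriv F (phase a (profile ℰ)) ε (j + 1) x) x := fun j x =>
    hasDerivAt_slowDeriv hF (hasDerivAt_phase hp x) j
  refine integral_trialDensity_nonneg hℰ ha hpos (hderiv 0) (hderiv 1) (hderiv 2)
    (continuous_of_hasDerivAt (hderiv 3)) fun x hx => ?_
  have hzero := slowDeriv_eq_zero hFR (le_abs_mul_phase hp hδ hspeed hε hx)
  exact ⟨hzero 0, hzero 1, hzero 2, hzero 3⟩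

theorem IsWave.exists_trialDensity_slowDeriv_le {p q : ℝ → ℝ} (hp : IsWave ℰ p q)
    (hp₁ : ∀ x, p x ^ 2 ≤ 1) (hδ : 0 < δ) (hspeed : ∀ x, δ ≤ phaseSpeed a (p x))
    (hκ : a * (2 + a - c) ≤ 0) (hF : ContDiff ℝ ∞ F) (hFc : HasCompactSupport F) (θ : ℝ → ℝ) :
    ∃ C, ∀ ε ∈ Set.Icc (0 : ℝ) 1, ∀ x,
      trialDensity a c (slowDeriv F θ ε 1 x) (slowDeriv F θ ε 2 x) (slowDeriv F θ ε 3 x)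
          (p x) (q x)
        ≤ a * (2 + a - c) * δ * (phaseSpeed a (p x) * slowDeriv F θ ε 1 x ^ 2)
          + ε ^ 3 * C := by
  choose M hM using exists_abs_iteratedDeriv_le hF hFc
  obtain ⟨C, hC⟩ := exists_abs_trialDensity_sub_le a c (M 1) (M 2) (M 3)
  refine ⟨C, fun ε hε x => ?_⟩
  have hpx : |p x| ≤ 1 := (sq_le_one_iff_abs_le_one _).1 (hp₁ x)
  have hqx : |q x| ≤ 1 := (sq_le_one_iff_abs_le_one _).1 (hp.sq_deriv_le_one (hp₁ x))
  have hbound := (abs_le.1 (hC ε hε _ _ _ _ _ (hM 1 (ε * θ x)) (hM 2 (ε * θ x))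
    (hM 3 (ε * θ x)) hpx hqx)).2
  have hcoef : δ * phaseSpeed a (p x) ≤ phaseSpeed a (p x) ^ 2 + 4 * a ^ 2 * q x ^ 2 := by
    nlinarith [hspeed x, sq_nonneg (a * q x)]
  have hleading := mul_le_mul_of_nonneg_right (mul_le_mul_of_nonpos_left hcoef hκ)
    (sq_nonneg (slowDeriv F θ ε 1 x))
  simp only [slowDeriv, pow_one] at hleading ⊢
  linarith

theorem IsWave.exists_integral_trialDensity_slowDeriv_le {p q : ℝ → ℝ} (hp : IsWave ℰ p q)
    (hp₁ : ∀ x, p x ^ 2 ≤ 1) (hδ : 0 < δ) (hspeed : ∀ x, δ ≤ phaseSpeed a (p x))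
    (hκ : a * (2 + a - c) ≤ 0) (hF : ContDiff ℝ ∞ F) (hFR : tsupport F ⊆ Metric.ball 0 R)
    (hR : 0 < R) :
    ∃ K, ∀ ε ∈ Set.Ioc (0 : ℝ) 1,
      ∫ x in -(R / (ε * δ))..R / (ε * δ),
        trialDensity a c (slowDeriv F (phase a p) ε 1 x) (slowDeriv F (phase a p) ε 2 x)
          (slowDeriv F (phase a p) ε 3 x) (p x) (q x)
        ≤ ε * (a * (2 + a - c) * δ * (∫ y, deriv F y ^ 2) + ε * K) := by
  have hpc := hp.continuous
  have hqc := hp.continuous_deriv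
  have hFc : HasCompactSupport F := HasCompactSupport.of_support_subset_isCompact
    (isCompact_closedBall 0 R) (subset_closure.trans (hFR.trans Metric.ball_subset_closedBall))
  obtain ⟨C, hC⟩ := hp.exists_trialDensity_slowDeriv_le hp₁ hδ hspeed hκ hF hFc (phase a p)
  refine ⟨2 * C * (R / δ), fun ε ⟨hε, hε₁⟩ => ?_⟩
  have hL : 0 ≤ R / (ε * δ) := by positivity
  have hg : ∀ j, Continuous (slowDeriv F (phase a p) ε j) := fun j =>
    continuous_of_hasDerivAt fun x => hasDerivAt_slowDeriv hF (hasDerivAt_phase hpc x) j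
  have hdens : Continuous fun x => trialDensity a c (slowDeriv F (phase a p) ε 1 x)
      (slowDeriv F (phase a p) ε 2 x) (slowDeriv F (phase a p) ε 3 x) (p x) (q x) := by
    unfold trialDensity trialDefect trialWronskian phaseSpeed
    fun_prop
  have hleading : Continuous fun x => a * (2 + a - c) * δ *
      (phaseSpeed a (p x) * slowDeriv F (phase a p) ε 1 x ^ 2) := by
    unfold phaseSpeed
    fun_prop
  refine (intervalIntegral.integral_mono_on (neg_le_self hL) (hdens.intervalIntegrable _ _)
    ((hleading.add continuous_const).intervalIntegrable _ _)
    fun x _ => hC ε ⟨hε.le, hε₁⟩ x).trans_eq ?_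
  simp only [Pi.add_apply]
  rw [intervalIntegral.integral_add (hleading.intervalIntegrable _ _)
    (continuous_const.intervalIntegrable _ _), intervalIntegral.integral_const_mul,
    integral_slowDeriv_one_sq hpc hδ hspeed (hF.of_le (by simp)) hFR hR hε,
    intervalIntegral.integral_const, smul_eq_mul]
  field_simp
  ring

theorem mul_two_add_sub_nonneg_of_secondVariation_nonneg (hℰ : ℰ ∈ Set.Ioo (0 : ℝ) 1)
    (ha : a ^ 2 = 1 - ℰ ^ 2) (hδ : 0 < δ) (hspeed : ∀ x, δ ≤ phaseSpeed a (profile ℰ x))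
    (hpos : ∀ φ φ₁ φ₂ : ℝ → ℂ, MemH2 φ φ₁ φ₂ → 0 ≤ secondVariation ℰ c φ φ₁ φ₂ φ φ₁ φ₂) :
    0 ≤ a * (2 + a - c) := by
  by_contra! hκ
  let F : ContDiffBump (0 : ℝ) := default
  have hF : ContDiff ℝ ∞ F := F.contDiff
  have hF₀ : F 0 ≠ 0 := (F.one_of_mem_closedBall (by simp [F.rIn_pos.le])).trans_ne one_ne_zero
  obtain ⟨R, hR, hFR⟩ := F.hasCompactSupport.isCompact.isBounded.subset_ball_lt 0 0
  have hprofile : ∀ x, profile ℰ x ^ 2 ≤ 1 := fun x =>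
    (profile_sq_le hℰ.2.le x).trans (sub_le_self 1 hℰ.1.le)
  obtain ⟨K, hK⟩ := (isWave_profile hℰ).exists_integral_trialDensity_slowDeriv_le hprofile hδ
    hspeed hκ.le hF hFR hR
  have hlower : ∀ ε ∈ Set.Ioc (0 : ℝ) 1,
      0 ≤ a * (2 + a - c) * δ * (∫ y, deriv F y ^ 2) + ε * K := fun ε hε =>
    nonneg_of_mul_nonneg_right ((integral_trialDensity_slowDeriv_nonneg hℰ ha hδ hspeed hpos hF hFR
      hε.1).trans (hK ε hε)) hε.1
  have hlimit : Filter.Tendsto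
      (fun ε : ℝ => a * (2 + a - c) * δ * (∫ y, deriv F y ^ 2) + ε * K) (nhdsWithin 0 (Set.Ioi 0))
      (nhds (a * (2 + a - c) * δ * (∫ y, deriv F y ^ 2) + 0 * K)) :=
    (Continuous.tendsto (by fun_prop) 0).mono_left nhdsWithin_le_nhds
  have hslope : 0 ≤ a * (2 + a - c) * δ * (∫ y, deriv F y ^ 2) := by
    simpa using ge_of_tendsto hlimit
      (Filter.mem_of_superset (Ioc_mem_nhdsGT one_pos) hlower)
  have hint := integral_deriv_sq_pos (hF.of_le (by simp)) F.hasCompactSupport hF₀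
  exact hslope.not_gt (mul_neg_of_neg_of_pos (mul_neg_of_neg_of_pos hκ hδ) hint)

end Slope

end NLSWave

theorem proposition2_general (ℰ : ℝ) (hℰ : ℰ ∈ Set.Ioo (0 : ℝ) 1) (c : ℝ)
    (hpos : ∀ φ φ₁ φ₂ : ℝ → ℂ, NLSWave.MemH2 φ φ₁ φ₂ →
      0 ≤ NLSWave.secondVariation ℰ c φ φ₁ φ₂ φ φ₁ φ₂) :
    c ∈ Set.Icc (NLSWave.cMinus ℰ) (NLSWave.cPlus ℰ) := by
  rw [NLSWave.cMinus, NLSWave.cPlus, NLSWave.two_mul_modulus_div hℰ]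
  set s := √(1 - ℰ ^ 2)
  have hsq : s ^ 2 = 1 - ℰ ^ 2 := Real.sq_sqrt (by nlinarith [hℰ.1, hℰ.2])
  have hs : 1 - ℰ < s := Real.lt_sqrt_of_sq_lt (by nlinarith [hℰ.1, hℰ.2])
  have hs₀ : 0 < s := (sub_pos.2 hℰ.2).trans hs
  have hlower : 0 ≤ -s * (2 + -s - c) :=
    NLSWave.mul_two_add_sub_nonneg_of_secondVariation_nonneg hℰ (by rw [neg_sq, hsq])
      (mul_pos hs₀ (sub_pos.2 hs)) (fun x => by
        rw [NLSWave.phaseSpeed]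
        nlinarith [NLSWave.profile_sq_le hℰ.2.le x]) hpos
  have hupper : 0 ≤ s * (2 + s - c) :=
    NLSWave.mul_two_add_sub_nonneg_of_secondVariation_nonneg hℰ hsq (mul_pos hs₀ hs₀)
      (fun x => mul_le_mul_of_nonneg_left (le_add_of_nonneg_left (sq_nonneg _)) hs₀.le) hpos
  exact ⟨by nlinarith, by nlinarith⟩

theorem proposition2 (ℰ : ℝ) (hℰ : ℰ ∈ Set.Ioo (0 : ℝ) 1) (c : ℝ) (hc : 1 ≤ c)
    (hpos : NLSWave.IsPositiveExceptSymmetries ℰ c) :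
    c ∈ Set.Icc (NLSWave.cMinus ℰ) (NLSWave.cPlus ℰ) :=
  proposition2_general ℰ hℰ c hpos.nonneg
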